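/- Let $(X,d)$ be a compact metric space, $f\colon X\to X$ a continuous map and $x\in X$. Definitions. For $y\in X$ let $\omega_f(y)$ be the $\omega$-limit set of $y$, i.e. the set of all limits $\lim_{j\to\infty}f^{i_j}(y)$ with $0\le i_1<i_2<\cdots$; it is non-empty and closed. The map $\omega_f$ is *upper semicontinuous* at $x$ if for every open $U\supset\omega_f(x)$ one has $\omega_f(y)\subset U$ for all $y$ sufficiently close to $x$; it is *lower semicontinuous* at $x$ if for every open $U$ with $U\cap\omega_f(x)\neq\emptyset$ one has $U\cap\omega_f(y)\ne\emptyset$ for all $y$ sufficiently close to $x$. Let $USC(\omega_f)$, $LSC(\omega_f)$ and $C(\omega_f)$ be the sets of points of upper semicontinuity, of lower semicontinuity, and of continuity with respect to the Hausdorff distance, respectively. A sequence $(x_i)_{i\ge0}$ in $X$ is a *$\delta$-pseudo orbit* if $d(f(x_i),x_{i+1})\le\delta$ for all $i\ge0$; it is *$\epsilon$-shadowed* by $y\in X$ if $d(x_i,f^i(y))\le\epsilon$ for all $i\ge0$. The point $x$ is *shadowable* if for every $\epsilon>0$ there is $\delta>0$ such that every $\delta$-pseudo orbit with $x_0=x$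 is $\epsilon$-shadowed by some $y\in X$; $f$ is *chain continuous* at $x$ if for every $\epsilon>0$ there is $\delta>0$ such that every $\delta$-pseudo orbit with $x_0=x$ is $\epsilon$-shadowed by $x$ itself. For $y,z\in X$ write $y\to z$ if for every $\delta>0$ there are $k\ge1$ and points $y=c_0,c_1,\dots,c_k=z$ with $d(f(c_i),c_{i+1})\le\delta$ for $0\le i<k$. A *chain component* of $f$ is an equivalence class of the relation "$y\to z$ and $z\to y$" on the set $\{y\in X: y\to y\}$; $C_f(x)$ denotes the unique chain component containing $\omega_f(x)$. A closed set $S\subset X$ with $f(S)\subset S$ is *chain stable* if $y\in S$ and $y\to z$ imply $z\in S$; a chain component is *terminal* if it is chain stable. For $K\subset X$, $n\ge1$ and $\epsilon>0$ let $r_n(K,\epsilon)$ be the least cardinality of a set $A\subset X$ such that for every $y\in K$ some $a\in A$ satisfies $d(f^i(y),f^i(a))\le\epsilon$ for $0\le i<n$, and put $h(f,K)=\lim_{\epsilon\to0}\limsup_{n\to\infty}\frac1n\log r_n(K,\epsilon)$. The point $x$ is an *entropy point* of $f$ if $h(f,K)>0$ for every closed neighborhood $K$ of $x$. Statement. Suppose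 that $x$ is shadowable. 1. If $C_f(x)$ is terminal and $x\notin C(\omega_f)$, then $x$ is an entropy point of $f$. 2. If $x\in USC(\omega_f)\cup LSC(\omega_f)$ and $f$ is not chain continuous at $x$, then $x$ is an entropy point of $f$. 3. If $x\in USC(\omega_f)\setminus LSC(\omega_f)$ or $x\in LSC(\omega_f)\setminus USC(\omega_f)$, then $x$ is an entropy point of $f$. -/

import Mathlib

open Filter Topology Set

namespace OmegaShadow

noncomputable section

/-- The omega-limit set `ω_f(x)`, as Mathlib's omega-limit of the one-point set `{x}`
under the iterates of `f`. -/
def omegaSet {X : Type*} [TopologicalSpace X] (f : X → X) (x : X) : Set X :=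
  omegaLimit atTop (fun n : ℕ => f^[n]) {x}

/-- `y ∈ ω_f(x)` iff `f^{i_j}(x) → y` for some strictly increasing sequence `i_j`. -/
theorem mem_omegaSet_iff {X : Type*} [MetricSpace X] (f : X → X) (x y : X) :
    y ∈ omegaSet f x ↔
      ∃ φ : ℕ → ℕ, StrictMono φ ∧ Tendsto (fun j => f^[φ j] x) atTop (𝓝 y) := by
  unfold omegaSet
  rw [mem_omegaLimit_singleton_iff_mapClusterPt]
  constructor
  · intro h
    obtain ⟨φ, hφ, h2⟩ := h.tendsto_subseq
    exact ⟨φ, hφ, h2⟩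
  · rintro ⟨φ, hφ, h2⟩
    exact MapClusterPt.of_comp hφ.tendsto_atTop h2.mapClusterPt

theorem omegaSet_nonempty {X : Type*} [TopologicalSpace X] [CompactSpace X]
    (f : X → X) (x : X) : (omegaSet f x).Nonempty :=
  nonempty_omegaLimit _ _ _ (singleton_nonempty x)

/-- The map `x ↦ ω_f(x)` into the space of non-empty compact (equivalently, since the space is
compact, non-empty closed) subsets, which carries the Hausdorff distance. -/
def omegaMap {X : Type*} [MetricSpace X] [CompactSpace X] (f : X → X) (x : X) :
    TopologicalSpace.NonemptyCompacts X where
  carrier := omegaSet f x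
  isCompact' := (isClosed_omegaLimit _ _ _).isCompact
  nonempty' := omegaSet_nonempty f x

/-- `x` is a continuity point of `ω_f` with respect to the Hausdorff distance. -/
def IsOmegaCont {X : Type*} [MetricSpace X] [CompactSpace X] (f : X → X) (x : X) : Prop :=
  ContinuousAt (omegaMap f) x

theorem isOmegaCont_iff {X : Type*} [MetricSpace X] [CompactSpace X] (f : X → X) (x : X) :
    IsOmegaCont f x ↔ ∀ ε > 0, ∃ δ > 0, ∀ y, dist y x < δ →
      Metric.hausdorffDist (omegaSet f y) (omegaSet f x) < ε :=
  Metric.continuousAt_iff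

/-- `x` is an upper semicontinuity point of `ω_f`. -/
def IsOmegaUSC {X : Type*} [MetricSpace X] (f : X → X) (x : X) : Prop :=
  UpperHemicontinuousAt (omegaSet f) x

theorem isOmegaUSC_iff {X : Type*} [MetricSpace X] (f : X → X) (x : X) :
    IsOmegaUSC f x ↔ ∀ U : Set X, IsOpen U → omegaSet f x ⊆ U →
      ∃ δ > 0, ∀ y, dist y x < δ → omegaSet f y ⊆ U := by
  simp only [IsOmegaUSC, upperHemicontinuousAt_iff_forall_isOpen, Metric.eventually_nhds_iff]

/-- `x` is a lower semicontinuity point of `ω_f`. -/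
def IsOmegaLSC {X : Type*} [MetricSpace X] (f : X → X) (x : X) : Prop :=
  LowerHemicontinuousAt (omegaSet f) x

theorem isOmegaLSC_iff {X : Type*} [MetricSpace X] (f : X → X) (x : X) :
    IsOmegaLSC f x ↔ ∀ U : Set X, IsOpen U → (omegaSet f x ∩ U).Nonempty →
      ∃ δ > 0, ∀ y, dist y x < δ → (omegaSet f y ∩ U).Nonempty := by
  simp only [IsOmegaLSC, lowerHemicontinuousAt_iff, Metric.eventually_nhds_iff]

/-- `(ξ 0, ξ 1, …)` is a `δ`-pseudo orbit of `f`. -/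
def IsPseudoOrbit {X : Type*} [MetricSpace X] (f : X → X) (δ : ℝ) (ξ : ℕ → X) : Prop :=
  ∀ i, dist (f (ξ i)) (ξ (i + 1)) ≤ δ

/-- `ξ` is `ε`-shadowed by `y`. -/
def IsShadowedBy {X : Type*} [MetricSpace X] (f : X → X) (ε : ℝ) (ξ : ℕ → X) (y : X) : Prop :=
  ∀ i, dist (ξ i) (f^[i] y) ≤ ε

/-- `x` is a shadowable point for `f`. -/
def IsShadowable {X : Type*} [MetricSpace X] (f : X → X) (x : X) : Prop :=
  ∀ ε > 0, ∃ δ > 0, ∀ ξ : ℕ → X, IsPseudoOrbit f δ ξ → ξ 0 = x → ∃ y, IsShadowedBy f ε ξ y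

/-- `f` is chain continuous at `x`. -/
def IsChainContAt {X : Type*} [MetricSpace X] (f : X → X) (x : X) : Prop :=
  ∀ ε > 0, ∃ δ > 0, ∀ ξ : ℕ → X, IsPseudoOrbit f δ ξ → ξ 0 = x → IsShadowedBy f ε ξ x

/-- `y → z`: for every `δ > 0` there is a `δ`-chain `(c 0, …, c k)`, `k ≥ 1`, from `y` to `z`. -/
def ChainTo {X : Type*} [MetricSpace X] (f : X → X) (y z : X) : Prop :=
  ∀ δ > 0, ∃ k ≥ 1, ∃ c : ℕ → X,
    c 0 = y ∧ c k = z ∧ ∀ i < k, dist (f (c i)) (c (i + 1)) ≤ δ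

/-- A chain stable set: closed, forward invariant, and closed under `→`. -/
def IsChainStable {X : Type*} [MetricSpace X] (f : X → X) (S : Set X) : Prop :=
  IsClosed S ∧ MapsTo f S S ∧ ∀ y ∈ S, ∀ z, ChainTo f y z → z ∈ S

/-- The chain recurrent set. -/
def chainRecurrentSet {X : Type*} [MetricSpace X] (f : X → X) : Set X :=
  {x | ChainTo f x x}

/-- Chain components: the classes of the relation `y → z` and `z → y` in the chain
recurrent set. -/
def IsChainComponent {X : Type*} [MetricSpace X] (f : X → X) (C : Set X) : Prop :=
  ∃ y ∈ chainRecurrentSet f,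
    C = {z | z ∈ chainRecurrentSet f ∧ ChainTo f y z ∧ ChainTo f z y}

/-- A terminal chain component. -/
def IsTerminal {X : Type*} [MetricSpace X] (f : X → X) (C : Set X) : Prop :=
  IsChainComponent f C ∧ IsChainStable f C

theorem ChainTo.trans {X : Type*} [MetricSpace X] {f : X → X} {x y z : X}
    (h₁ : ChainTo f x y) (h₂ : ChainTo f y z) : ChainTo f x z := by
  intro δ hδ
  obtain ⟨k, hk, c, c0, ck, hc⟩ := h₁ δ hδ
  obtain ⟨l, hl, e, e0, el, he⟩ := h₂ δ hδ
  refine ⟨k + l, by omega, fun i => if i ≤ k then c i else e (i - k), by simp [c0], ?_, ?_⟩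
  · have : ¬ (k + l ≤ k) := by omega
    simp [this, el]
  · intro i hi
    rcases lt_trichotomy i k with h | h | h
    · have h1 : i ≤ k := h.le
      have h2 : i + 1 ≤ k := h
      simpa [h1, h2] using hc i h
    · subst h
      have h2 : ¬ (i + 1 ≤ i) := by omega
      have h3 := he 0 (by omega)
      simpa [h2, ck, e0] using h3
    · have h1 : ¬ (i ≤ k) := by omega
      have h2 : ¬ (i + 1 ≤ k) := by omega
      have h3 := he (i - k) (by omega)
      have h4 : i + 1 - k = i - k + 1 := by omega
      simpa [h1, h2, h4] using h3

theorem chainTo_of_mem_omegaSet {X : Type*} [MetricSpace X] {f : X → X} (hf : Continuous f)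
    {x y z : X} (hy : y ∈ omegaSet f x) (hz : z ∈ omegaSet f x) : ChainTo f y z := by
  intro δ hδ
  obtain ⟨φ, hφ, hφy⟩ := (mem_omegaSet_iff f x y).1 hy
  obtain ⟨ψ, hψ, hψz⟩ := (mem_omegaSet_iff f x z).1 hz
  have h1 := (hf.tendsto y).comp hφy
  obtain ⟨a, ha⟩ := (h1.eventually (Metric.ball_mem_nhds _ hδ)).exists
  obtain ⟨b, hb, hb'⟩ := ((hψz.eventually (Metric.ball_mem_nhds _ hδ)).and
    (hψ.tendsto_atTop.eventually_ge_atTop (φ a + 2))).exists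
  refine ⟨ψ b - φ a, by omega,
    fun i => if i = 0 then y else if i = ψ b - φ a then z else f^[φ a + i] x, by simp, ?_, ?_⟩
  · have : ψ b - φ a ≠ 0 := by omega
    simp [this]
  · intro i hi
    rcases Nat.eq_zero_or_pos i with h0 | h0
    · subst h0
      have h2 : ¬ (1 = ψ b - φ a) := by omega
      have h3 : dist (f (f^[φ a] x)) (f y) < δ := ha
      rw [← Function.iterate_succ_apply' f, dist_comm] at h3
      simpa [h2] using h3.le
    · have h2 : i ≠ 0 := by omega
      have h3 : i ≠ ψ b - φ a := by omega
      by_cases h4 : i + 1 = ψ b - φ a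
      · have h5 : (φ a + i) + 1 = ψ b := by omega
        have h6 : dist (f^[ψ b] x) z < δ := hb
        rw [← h5, Function.iterate_succ_apply'] at h6
        simp only [h2, h3, h4, if_true, if_false]
        rw [if_neg (by omega)]
        exact h6.le
      · have h5 : f (f^[φ a + i] x) = f^[φ a + (i + 1)] x :=
          (Function.iterate_succ_apply' f (φ a + i) x).symm
        simp only [h2, h3, h4, if_false]
        rw [if_neg (by omega), h5, dist_self]
        exact hδ.le

/-- There is exactly one chain component containing `ω_f(x)`. -/
theorem existsUnique_chainComponent {X : Type*} [MetricSpace X] [CompactSpace X]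
    {f : X → X} (hf : Continuous f) (x : X) :
    ∃! C : Set X, IsChainComponent f C ∧ omegaSet f x ⊆ C := by
  obtain ⟨p, hp⟩ := omegaSet_nonempty f x
  have hpp : ChainTo f p p := chainTo_of_mem_omegaSet hf hp hp
  refine ⟨{z | z ∈ chainRecurrentSet f ∧ ChainTo f p z ∧ ChainTo f z p}, ⟨⟨p, hpp, rfl⟩, ?_⟩, ?_⟩
  · intro z hz
    exact ⟨chainTo_of_mem_omegaSet hf hz hz, chainTo_of_mem_omegaSet hf hp hz,
      chainTo_of_mem_omegaSet hf hz hp⟩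
  · rintro C ⟨⟨q, hq, rfl⟩, hC⟩
    obtain ⟨-, hqp, hpq⟩ := hC hp
    ext z
    exact ⟨fun ⟨h, h1, h2⟩ => ⟨h, hpq.trans h1, h2.trans hqp⟩,
      fun ⟨h, h1, h2⟩ => ⟨h, hqp.trans h1, h2.trans hpq⟩⟩

/-- `C_f(x)`: the unique chain component containing `ω_f(x)`. -/
def chainComponentOf {X : Type*} [MetricSpace X] (f : X → X) (x : X) : Set X :=
  ⋃₀ {C | IsChainComponent f C ∧ omegaSet f x ⊆ C}

theorem chainComponentOf_eq_iff {X : Type*} [MetricSpace X] [CompactSpace X]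
    {f : X → X} (hf : Continuous f) (x : X) (C : Set X) :
    chainComponentOf f x = C ↔ IsChainComponent f C ∧ omegaSet f x ⊆ C := by
  obtain ⟨D, hD, huniq⟩ := existsUnique_chainComponent hf x
  have hset : {C : Set X | IsChainComponent f C ∧ omegaSet f x ⊆ C} = {D} := by
    ext E
    exact ⟨fun h => huniq E h, fun h => by rw [mem_singleton_iff.1 h]; exact hD⟩
  rw [chainComponentOf, hset, sUnion_singleton]
  exact ⟨fun h => h ▸ hD, fun h => (huniq C h).symm⟩

/-- `x` is an entropy point for `f`: the topological entropy of `f` on every closed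
neighborhood of `x` is positive. -/
def IsEntropyPoint {X : Type*} [MetricSpace X] (f : X → X) (x : X) : Prop :=
  ∀ K ∈ 𝓝 x, IsClosed K → 0 < Dynamics.coverEntropy f K

end

end OmegaShadow

/-!
The proof rests on one mechanism and one consequence of it.

*Entropy from two routes.* Suppose that, for a fixed `e > 0` and every `δ > 0`, some point `p` is
reached from `x` by a `δ`-chain, two `δ`-chains of equal length lead from `p` to points `q`, `q'`
at distance greater than `e`, and both `q` and `q'` return to `p` by `δ`-chains. Visiting `q` first
and `q'` second, or the other way round, gives two loops at `p` of equal length that are `e`-apart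
at a common time. Their `2 ^ k` concatenations are pseudo orbits from `x`; shadowing them yields
`2 ^ k` separated orbit segments, of length linear in `k`, which start as close to `x` as desired.
So a shadowable `x` is an entropy point (`isEntropyPoint_of_returns`).

*Chain continuity.* Fix `p ∈ ω_f(x)` and suppose that `p → z` implies `z → p`. By compactness the
return is uniform (`exists_uniform_return`). The orbit of `x` comes close to `p`, and so does every
fine pseudo orbit from `x`; from then on both are fine chains from `p` whose ends return to `p`.
If `x` is shadowable and not an entropy point, the first part forces them to stay close, so `f` is
chain continuous at `x` (`isChainContAt_of_return`).

The hypothesis on `p` holds if `C_f(x)` is terminal, by definition, and also if `ω_f` is upper or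
lower semicontinuous at `x`: shadowing a chain from `x` to `z` followed by the orbit of `z` gives
points `y` near `x` with `ω_f(y)` near `ω_f(z)`, whence `ω_f(z) ⊆ ω_f(x)` or `ω_f(x) ⊆ ω_f(z)`, and
`z` returns to `ω_f(x)` in either case. Finally, chain continuity at `x` makes the orbits of all
points near `x` uniformly close to that of `x`, so `ω_f` is then continuous, upper semicontinuous
and lower semicontinuous at `x`.
-/

namespace OmegaShadow

open Dynamics

variable {X : Type*} [MetricSpace X] {f : X → X}

/-! ### Chains of prescribed length -/

/-- There is a `δ`-chain of length exactly `n` from `y` to `z`, so that `ChainTo f y z` says that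
for each `δ > 0` this holds for some `n ≥ 1`. Length `0` is allowed and means `y = z`. -/
def Reach (f : X → X) (δ : ℝ) (n : ℕ) (y z : X) : Prop :=
  ∃ c : ℕ → X, c 0 = y ∧ c n = z ∧ ∀ i < n, dist (f (c i)) (c (i + 1)) ≤ δ

theorem Reach.mono {δ δ' : ℝ} {n : ℕ} {y z : X} (h : Reach f δ n y z) (hδ : δ ≤ δ') :
    Reach f δ' n y z := by
  obtain ⟨c, h0, hn, hc⟩ := h
  exact ⟨c, h0, hn, fun i hi => (hc i hi).trans hδ⟩

/-- Concatenation, keeping track of the time at which the middle point is visited. -/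
theorem Reach.exists_chain_through {δ : ℝ} {a b : ℕ} {y z w : X}
    (h₁ : Reach f δ a y z) (h₂ : Reach f δ b z w) :
    ∃ c : ℕ → X, c 0 = y ∧ c a = z ∧ c (a + b) = w ∧
      ∀ i < a + b, dist (f (c i)) (c (i + 1)) ≤ δ := by
  obtain ⟨c, c0, ck, hc⟩ := h₁
  obtain ⟨e, e0, el, he⟩ := h₂
  refine ⟨fun i => if i ≤ a then c i else e (i - a), by simp [c0], by simp [ck], ?_, ?_⟩
  · rcases Nat.eq_zero_or_pos b with rfl | hb
    · simp [ck, ← el, e0]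
    · have : ¬ (a + b ≤ a) := by omega
      simp [this, el]
  · intro i hi
    rcases lt_trichotomy i a with h | h | h
    · have h1 : i ≤ a := h.le
      have h2 : i + 1 ≤ a := h
      simpa [h1, h2] using hc i h
    · subst h
      have h2 : ¬ (i + 1 ≤ i) := by omega
      have h3 := he 0 (by omega)
      simpa [h2, ck, e0] using h3
    · have h1 : ¬ (i ≤ a) := by omega
      have h2 : ¬ (i + 1 ≤ a) := by omega
      have h3 := he (i - a) (by omega)
      have h4 : i + 1 - a = i - a + 1 := by omega
      simpa [h1, h2, h4] using h3

theorem Reach.trans {δ : ℝ} {a b : ℕ} {y z w : X}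
    (h₁ : Reach f δ a y z) (h₂ : Reach f δ b z w) : Reach f δ (a + b) y w := by
  obtain ⟨c, h0, -, hn, hc⟩ := h₁.exists_chain_through h₂
  exact ⟨c, h0, hn, hc⟩

theorem Reach.change_end {δ η : ℝ} {n : ℕ} {y z z' : X} (h : Reach f δ n y z) (hn : 1 ≤ n)
    (hη : 0 ≤ η) (hz : dist z z' ≤ η) : Reach f (δ + η) n y z' := by
  obtain ⟨c, h0, hcn, hc⟩ := h
  refine ⟨Function.update c n z', ?_, by simp, fun i hi => ?_⟩
  · rw [Function.update_of_ne (by omega), h0]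
  · rw [Function.update_of_ne hi.ne]
    rcases eq_or_ne (i + 1) n with h | h
    · subst h
      rw [Function.update_self]
      have := hc i hi
      rw [hcn] at this
      exact (dist_triangle _ _ _).trans (add_le_add this hz)
    · rw [Function.update_of_ne h]
      linarith [hc i hi]

theorem Reach.change_start {δ η : ℝ} {n : ℕ} {y y' z : X} (h : Reach f δ n y z) (hn : 1 ≤ n)
    (hη : 0 ≤ η) (hy : dist (f y') (f y) ≤ η) : Reach f (δ + η) n y' z := by
  obtain ⟨c, h0, hcn, hc⟩ := h
  refine ⟨Function.update c 0 y', by simp, ?_, fun i hi => ?_⟩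
  · rw [Function.update_of_ne (by omega), hcn]
  · rw [Function.update_of_ne (Nat.succ_ne_zero i)]
    rcases Nat.eq_zero_or_pos i with rfl | h
    · rw [Function.update_self]
      have := hc 0 hi
      rw [h0] at this
      linarith [dist_triangle (f y') (f y) (c (0 + 1))]
    · rw [Function.update_of_ne h.ne']
      linarith [hc i hi]

theorem chainTo_of_mem_omegaSet_self {x p : X} (hp : p ∈ omegaSet f x) :
    ChainTo f x p := by
  intro δ hδ
  obtain ⟨φ, hφ, hp⟩ := (mem_omegaSet_iff f x p).1 hp
  obtain ⟨j, hj, hj1⟩ := ((hp.eventually (Metric.ball_mem_nhds _ hδ)).and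
    (hφ.tendsto_atTop.eventually_ge_atTop 1)).exists
  refine ⟨φ j, hj1, ?_⟩
  have h : Reach f 0 (φ j) x (f^[φ j] x) :=
    ⟨fun i => f^[i] x, rfl, rfl, fun i _ => by simp [Function.iterate_succ_apply']⟩
  have h' := h.change_end hj1 hδ.le (le_of_lt hj)
  rwa [zero_add] at h'

/-! ### Entropy from freely concatenated loops -/

theorem expGrowthSup_pos_of_two_pow_le {u : ℕ → ENNReal} (a N : ℕ)
    (hN : 0 < N) (h : ∀ k : ℕ, (2 : ENNReal) ^ k ≤ u (a + k * N)) :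
    0 < ExpGrowth.expGrowthSup u := by
  have hb : 0 < Real.log 2 / (N + 1) := div_pos (Real.log_pos one_lt_two) (by positivity)
  refine lt_of_lt_of_le (b := ((Real.log 2 / (N + 1) : ℝ) : EReal)) (by exact_mod_cast hb) ?_
  refine Frequently.le_expGrowthSup (frequently_atTop.2 fun m => ?_)
  refine ⟨a + (a + m) * N, ?_, le_trans ?_ (h (a + m))⟩
  · nlinarith
  · have h1 : ((Real.log 2 / (N + 1) : ℝ) : EReal) * ((a + (a + m) * N : ℕ) : EReal)
        = ((Real.log 2 / (N + 1) * ((a + (a + m) * N : ℕ) : ℝ) : ℝ) : EReal) := by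
      rw [EReal.coe_mul]; rfl
    have h2 : (2 : ENNReal) ^ (a + m) = ENNReal.ofReal (2 ^ (a + m)) := by
      rw [ENNReal.ofReal_pow (by norm_num)]; norm_num
    rw [h1, EReal.exp_coe, h2]
    apply ENNReal.ofReal_le_ofReal
    rw [← Real.exp_log (show (0 : ℝ) < 2 ^ (a + m) by positivity), Real.log_pow]
    apply Real.exp_le_exp.2
    have hl : (0 : ℝ) ≤ Real.log 2 := Real.log_nonneg one_le_two
    rw [div_mul_eq_mul_div, div_le_iff₀ (by positivity)]
    push_cast
    have hm : (0 : ℝ) ≤ m := m.cast_nonneg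
    nlinarith [mul_nonneg hl hm]

theorem two_pow_le_netMaxcard {K : Set X} {k n : ℕ} {η : ℝ} (hη : 0 < η) (y : Finset ℕ → X)
    (hK : ∀ s, y s ∈ K)
    (hsep : ∀ s ⊆ Finset.range k, ∀ t ⊆ Finset.range k, s ≠ t →
      ∃ m < n, η + η ≤ dist (f^[m] (y s)) (f^[m] (y t))) :
    ((2 ^ k : ℕ) : ℕ∞) ≤ netMaxcard f K {p | dist p.1 p.2 < η} n := by
  classical
  have hinj : Set.InjOn y (Finset.range k).powerset := by
    intro s hs t ht hst
    by_contra hne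
    obtain ⟨m, -, hm⟩ := hsep s (Finset.mem_powerset.1 (Finset.mem_coe.1 hs)) t
      (Finset.mem_powerset.1 (Finset.mem_coe.1 ht)) hne
    rw [hst, dist_self] at hm
    linarith
  have hnet : IsDynNetIn f K {p | dist p.1 p.2 < η} n
      (((Finset.range k).powerset.image y : Finset X) : Set X) := by
    refine ⟨?_, ?_⟩
    · intro z hz
      obtain ⟨s, -, rfl⟩ := Finset.mem_image.1 (Finset.mem_coe.1 hz)
      exact hK s
    · intro z hz w hw hzw
      obtain ⟨s, hs, rfl⟩ := Finset.mem_image.1 (Finset.mem_coe.1 hz)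
      obtain ⟨t, ht, rfl⟩ := Finset.mem_image.1 (Finset.mem_coe.1 hw)
      obtain ⟨m, hmn, hm⟩ := hsep s (Finset.mem_powerset.1 hs) t (Finset.mem_powerset.1 ht)
        (fun h => hzw (by rw [h]))
      refine Set.disjoint_left.2 fun v hv hv' => ?_
      have h1 : dist (f^[m] (y s)) (f^[m] v) < η := mem_ball_dynEntourage.1 hv m hmn
      have h2 : dist (f^[m] (y t)) (f^[m] v) < η := mem_ball_dynEntourage.1 hv' m hmn
      linarith [dist_triangle_right (f^[m] (y s)) (f^[m] (y t)) (f^[m] v)]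
  have := hnet.card_le_netMaxcard
  rwa [Finset.card_image_of_injOn hinj, Finset.card_powerset, Finset.card_range] at this

/-- After a chain of length `a` from `x` to `p`, two loops of equal length `N` at `p` can be
followed in any prescribed order `w`. -/
theorem exists_pseudoOrbit_of_loops {δ : ℝ} {x p : X} {a N : ℕ} (hN : 0 < N)
    (h : Reach f δ a x p) (L : Bool → ℕ → X) (h0 : ∀ b, L b 0 = p) (hLN : ∀ b, L b N = p)
    (hL : ∀ b, ∀ i < N, dist (f (L b i)) (L b (i + 1)) ≤ δ) (w : ℕ → Bool) :
    ∃ ξ : ℕ → X, IsPseudoOrbit f δ ξ ∧ ξ 0 = x ∧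
      ∀ j, ∀ i < N, ξ (a + j * N + i) = L (w j) i := by
  obtain ⟨c, c0, ca, hc⟩ := h
  -- From time `a` on, the position is the point at time `r` of the `j`-th loop.
  let ξ : ℕ → X := fun n => if n < a then c n else L (w ((n - a) / N)) ((n - a) % N)
  have hlt : ∀ n < a, ξ n = c n := fun n hn => if_pos hn
  have key : ∀ j, ∀ i < N, ξ (a + j * N + i) = L (w j) i := by
    intro j i hi
    have h1 : ¬ (a + j * N + i < a) := by omega
    have h2 : a + j * N + i - a = i + N * j := by
      rw [add_assoc, Nat.add_sub_cancel_left, mul_comm, add_comm]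
    simp only [ξ, h1, if_false, h2]
    rw [Nat.add_mul_div_left _ _ hN, Nat.add_mul_mod_self_left, Nat.div_eq_of_lt hi,
      Nat.mod_eq_of_lt hi, zero_add]
  have ha : ξ a = p := by simpa [h0] using key 0 0 hN
  refine ⟨ξ, fun n => ?_, ?_, key⟩
  · rcases lt_or_ge n a with hn | hn
    · rw [hlt n hn]
      rcases lt_or_ge (n + 1) a with h' | h'
      · rw [hlt _ h']
        exact hc n hn
      · obtain rfl : n + 1 = a := by omega
        rw [ha, ← ca]
        exact hc n hn
    · obtain ⟨j, i, hi, rfl⟩ : ∃ j i, i < N ∧ n = a + j * N + i :=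
        ⟨(n - a) / N, (n - a) % N, Nat.mod_lt _ hN, by
          have := Nat.div_add_mod' (n - a) N; omega⟩
      rw [key j i hi]
      rcases lt_or_ge (i + 1) N with h' | h'
      · rw [add_assoc, key j (i + 1) h']
        exact hL _ i hi
      · have h3 : i + 1 = N := by omega
        have h4 : a + j * N + i + 1 = a + (j + 1) * N + 0 := by rw [add_mul]; omega
        rw [h4, key (j + 1) 0 hN, h0, ← hLN (w j), ← h3]
        exact hL _ i hi
  · rcases Nat.eq_zero_or_pos a with h' | h'
    · rw [h'] at ha ca
      rw [ha, ← ca, c0]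
    · rw [hlt 0 h', c0]

/-- If arbitrarily fine chains from `x` lead to points `p` with two loops of equal length that are
`e`-apart at some time, then shadowing the `2 ^ k` concatenations of `k` loops gives separated
orbits starting near `x`. -/
theorem isEntropyPoint_of_loops {x : X} (hx : IsShadowable f x) {e : ℝ} (he : 0 < e)
    (h : ∀ δ > 0, ∃ p, ∃ a N i : ℕ, ∃ L : Bool → ℕ → X, Reach f δ a x p ∧ i < N ∧
      (∀ b, L b 0 = p) ∧ (∀ b, L b N = p) ∧
      (∀ b, ∀ i < N, dist (f (L b i)) (L b (i + 1)) ≤ δ) ∧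
      e < dist (L true i) (L false i)) : IsEntropyPoint f x := by
  classical
  intro K hK _
  obtain ⟨r, hr, hrK⟩ := Metric.nhds_basis_closedBall.mem_iff.1 hK
  obtain ⟨δ, hδ, hsh⟩ := hx (min r (e / 4)) (by positivity)
  obtain ⟨p, a, N, i, L, hxp, hi, h0, hLN, hL, hsep⟩ := h δ hδ
  have hN : 0 < N := by omega
  choose ξ hξ hξ0 hξL using exists_pseudoOrbit_of_loops hN hxp L h0 hLN hL
  choose y hy using fun w => hsh (ξ w) (hξ w) (hξ0 w)
  have hyK : ∀ w, y w ∈ K := fun w => hrK <| by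
    have := hy w 0
    rw [hξ0, Function.iterate_zero, id, dist_comm] at this
    exact this.trans (min_le_left _ _)
  have hsep' : ∀ w w' : ℕ → Bool, ∀ j, w j ≠ w' j →
      e / 8 + e / 8 ≤ dist (f^[a + j * N + i] (y w)) (f^[a + j * N + i] (y w')) := by
    intro w w' j hj
    have h1 := (hy w (a + j * N + i)).trans (min_le_right _ _)
    have h2 := (hy w' (a + j * N + i)).trans (min_le_right _ _)
    rw [hξL w j i hi] at h1
    rw [hξL w' j i hi] at h2
    have h3 : e < dist (L (w j) i) (L (w' j) i) := by
      cases hw : w j <;> cases hw' : w' j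
      · exact absurd (hw.trans hw'.symm) hj
      · rwa [dist_comm]
      · exact hsep
      · exact absurd (hw.trans hw'.symm) hj
    have h4 := dist_triangle4 (L (w j) i) (f^[a + j * N + i] (y w)) (f^[a + j * N + i] (y w'))
      (L (w' j) i)
    rw [dist_comm (f^[a + j * N + i] (y w')) (L (w' j) i)] at h4
    linarith
  have hη : 0 < e / 8 := by positivity
  refine lt_of_lt_of_le ?_ (netEntropyEntourage_le_coverEntropy f K (Metric.dist_mem_uniformity hη))
  refine expGrowthSup_pos_of_two_pow_le a N hN fun k => ?_
  have hcard := two_pow_le_netMaxcard (f := f) (K := K) (k := k) (n := a + k * N) hη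
    (fun s => y (fun j => decide (j ∈ s))) (fun s => hyK _) (by
      intro s hs t ht hst
      obtain ⟨j, hj⟩ : ∃ j, ¬ (j ∈ s ↔ j ∈ t) := by
        by_contra! hcon
        exact hst (Finset.ext hcon)
      have hjk : j < k := by
        by_contra hjk
        have h1 : j ∉ s := fun hjs => hjk (Finset.mem_range.1 (hs hjs))
        have h2 : j ∉ t := fun hjt => hjk (Finset.mem_range.1 (ht hjt))
        tauto
      refine ⟨a + j * N + i, ?_, hsep' _ _ j (by simpa using hj)⟩
      have : (j + 1) * N ≤ k * N := Nat.mul_le_mul_right N hjk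
      rw [add_mul] at this
      omega)
  have := ENat.toENNReal_mono hcard
  simpa using this

/-- The loops are produced by visiting `q` and `q'` in either order: `p → q → p → q' → p` and
`p → q' → p → q → p` have the same length, whatever the lengths of the two returns, and they are
at `q` and at `q'` at the same time. -/
theorem isEntropyPoint_of_returns {x : X} (hx : IsShadowable f x) {e : ℝ} (he : 0 < e)
    (h : ∀ δ > 0, ∃ p q q' : X, ∃ a i m m' : ℕ, 1 ≤ m ∧ 1 ≤ m' ∧ Reach f δ a x p ∧
      Reach f δ i p q ∧ Reach f δ i p q' ∧ Reach f δ m q p ∧ Reach f δ m' q' p ∧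
      e < dist q q') : IsEntropyPoint f x := by
  refine isEntropyPoint_of_loops hx he fun δ hδ => ?_
  obtain ⟨p, q, q', a, i, m, m', hm, hm', hxp, hq, hq', hqp, hqp', hd⟩ := h δ hδ
  obtain ⟨c, c0, ci, cn, hc⟩ := hq.exists_chain_through (hqp.trans (hq'.trans hqp'))
  obtain ⟨c', c0', ci', cn', hc'⟩ := hq'.exists_chain_through (hqp'.trans (hq.trans hqp))
  have hlen : i + (m' + (i + m)) = i + (m + (i + m')) := by omega
  rw [hlen] at cn' hc'
  refine ⟨p, a, i + (m + (i + m')), i, fun b => if b then c else c', hxp, by omega, ?_, ?_, ?_,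
    by simpa [ci, ci'] using hd⟩
  · rintro (_ | _) <;> simpa
  · rintro (_ | _) <;> simpa
  · rintro (_ | _)
    · simpa using hc'
    · simpa using hc

/-! ### Chain continuity from returning chains -/

/-- If every point reachable from `p` by chains leads back to `p`, then so does, up to an error
`δ₁`, the end of each sufficiently fine chain from `p`. -/
theorem exists_uniform_return [CompactSpace X] (hf : Continuous f) {p : X}
    (hp : ∀ z, ChainTo f p z → ChainTo f z p) {δ₁ : ℝ} (hδ₁ : 0 < δ₁) :
    ∃ δ₂ > 0, ∀ k ≥ 1, ∀ z, Reach f δ₂ k p z → ∃ m ≥ 1, Reach f δ₁ m z p := by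
  by_contra! hcon
  choose k hk z hz hno using fun n : ℕ => hcon (1 / ((n : ℝ) + 1)) Nat.one_div_pos_of_nat
  obtain ⟨w, φ, hφ, hw⟩ := CompactSpace.tendsto_subseq z
  have hpw : ChainTo f p w := by
    intro δ hδ
    obtain ⟨n, hn, hn'⟩ := ((hw.eventually (Metric.ball_mem_nhds _ (half_pos hδ))).and
      ((tendsto_one_div_add_atTop_nhds_zero_nat.comp hφ.tendsto_atTop).eventually
        (gt_mem_nhds (half_pos hδ)))).exists
    refine ⟨k (φ n), hk _, ?_⟩
    have := ((hz (φ n)).mono (le_of_lt hn')).change_end (hk _) (half_pos hδ).le (le_of_lt hn)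
    rwa [add_halves] at this
  obtain ⟨m, hm, hwp⟩ := hp w hpw (δ₁ / 2) (half_pos hδ₁)
  obtain ⟨n, hn⟩ := (((hf.tendsto w).comp hw).eventually
    (Metric.ball_mem_nhds _ (half_pos hδ₁))).exists
  have h' := Reach.change_start hwp hm (half_pos hδ₁).le (le_of_lt hn)
  rw [add_halves] at h'
  exact hno _ m hm h'

theorem exists_pseudoOrbit_close (hf : Continuous f) (x : X) (n : ℕ) :
    ∀ η > 0, ∃ δ > 0, ∀ ξ : ℕ → X, IsPseudoOrbit f δ ξ → ξ 0 = x →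
      ∀ i ≤ n, dist (ξ i) (f^[i] x) < η := by
  induction n with
  | zero =>
    intro η hη
    refine ⟨1, one_pos, fun ξ _ h0 i hi => ?_⟩
    obtain rfl : i = 0 := by omega
    simpa [h0] using hη
  | succ n ih =>
    intro η hη
    obtain ⟨η', hη', hcont⟩ := Metric.continuousAt_iff.1 (hf.continuousAt (x := f^[n] x)) (η / 2)
      (half_pos hη)
    obtain ⟨δ, hδ, h⟩ := ih (min η η') (lt_min hη hη')
    refine ⟨min δ (η / 2), lt_min hδ (half_pos hη), fun ξ hξ h0 i hi => ?_⟩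
    have h1 := h ξ (fun i => (hξ i).trans (min_le_left _ _)) h0
    rcases Nat.lt_or_ge n i with hni | hni
    · obtain rfl : i = n + 1 := by omega
      have h2 := hcont ((h1 n le_rfl).trans_le (min_le_right _ _))
      have h3 := (hξ n).trans (min_le_right _ _)
      rw [Function.iterate_succ_apply']
      linarith [dist_triangle_left (ξ (n + 1)) (f (f^[n] x)) (f (ξ n))]
    · exact (h1 i hni).trans_le (min_le_left _ _)

/-- A pseudo orbit from `x` stays close to the orbit of `x` until the latter is close to
`p ∈ ω_f(x)`; from then on both are fine chains from `p` of equal length, and if they came apart,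
their returns to `p` would yield entropy. -/
theorem isChainContAt_of_return [CompactSpace X] (hf : Continuous f) {x p : X}
    (hx : IsShadowable f x) (hpx : p ∈ omegaSet f x)
    (hp : ∀ z, ChainTo f p z → ChainTo f z p) (hent : ¬ IsEntropyPoint f x) :
    IsChainContAt f x := by
  intro e he
  obtain ⟨δ₁, hδ₁, hH⟩ : ∃ δ > 0, ∀ (q q' : X) (a i m m' : ℕ), 1 ≤ m → 1 ≤ m' →
      Reach f δ a x p → Reach f δ i p q → Reach f δ i p q' → Reach f δ m q p →
      Reach f δ m' q' p → dist q q' ≤ e := by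
    by_contra! hcon
    exact hent <| isEntropyPoint_of_returns hx he fun δ hδ => ⟨p, hcon δ hδ⟩
  obtain ⟨δ₂', hδ₂', hret⟩ := exists_uniform_return hf hp hδ₁
  obtain ⟨a, -, hxp⟩ := chainTo_of_mem_omegaSet_self hpx δ₁ hδ₁
  set δ₂ := min δ₁ δ₂' with hδ₂def
  have hδ₂ : 0 < δ₂ := lt_min hδ₁ hδ₂'
  obtain ⟨φ, -, hφ⟩ := (mem_omegaSet_iff f x p).1 hpx
  obtain ⟨j, hj⟩ := (((hf.tendsto p).comp hφ).eventually
    (Metric.ball_mem_nhds _ (show 0 < δ₂ / 3 by positivity))).exists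
  set n := φ j
  have hn : dist (f p) (f (f^[n] x)) ≤ δ₂ / 3 := by rw [dist_comm]; exact le_of_lt hj
  obtain ⟨η, hη, hcont⟩ := Metric.continuousAt_iff.1 (hf.continuousAt (x := f^[n] x)) (δ₂ / 3)
    (by positivity)
  obtain ⟨δ₃, hδ₃, hclose⟩ := exists_pseudoOrbit_close hf x n (min e η) (lt_min he hη)
  -- The tail of a pseudo orbit passing near `f^[n] x` at time `n` can be started at `p`.
  have htail : ∀ ζ : ℕ → X, IsPseudoOrbit f (δ₂ / 3) ζ →
      dist (f (ζ n)) (f (f^[n] x)) ≤ δ₂ / 3 → ∀ i ≥ 1, Reach f δ₂ i p (ζ (n + i)) := by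
    intro ζ hζ hζn i hi
    have h : Reach f (δ₂ / 3) i (ζ n) (ζ (n + i)) := ⟨fun l => ζ (n + l), rfl, rfl, fun l _ => hζ _⟩
    have h' := h.change_start (y' := p) (η := δ₂ / 3 + δ₂ / 3) hi (by positivity)
      ((dist_triangle_right _ _ (f (f^[n] x))).trans (add_le_add hn hζn))
    exact h'.mono (by linarith)
  refine ⟨min δ₃ (δ₂ / 3), by positivity, fun ξ hξ h0 i => ?_⟩
  have hc := hclose ξ (fun i => (hξ i).trans (min_le_left _ _)) h0
  rcases Nat.lt_or_ge n i with hni | hni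
  · obtain ⟨l, rfl⟩ := Nat.exists_eq_add_of_le hni.le
    have hl : 1 ≤ l := by omega
    have r1 := htail ξ (fun i => (hξ i).trans (min_le_right _ _))
      (hcont ((hc n le_rfl).trans_le (min_le_right _ _))).le l hl
    have r2 := htail (fun i => f^[i] x)
      (fun i => by simp only [Function.iterate_succ_apply', dist_self]; positivity)
      (by rw [dist_self]; positivity) l hl
    obtain ⟨m, hm, s1⟩ := hret l hl _ (r1.mono (min_le_right _ _))
    obtain ⟨m', hm', s2⟩ := hret l hl _ (r2.mono (min_le_right _ _))
    exact hH _ _ a l m m' hm hm' hxp (r1.mono (min_le_left _ _)) (r2.mono (min_le_left _ _)) s1 s2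
  · exact (hc i hni).le.trans (min_le_left _ _)

/-! ### Omega-limit sets of nearby orbits -/

theorem omegaSet_iterate (a : ℕ) (y : X) : omegaSet f (f^[a] y) = omegaSet f y := by
  have h : (fun n => f^[n] (f^[a] y)) = fun n => f^[n + a] y := by
    funext n; rw [Function.iterate_add_apply]
  ext z
  simp only [omegaSet, mem_omegaLimit_singleton_iff_mapClusterPt, h]
  have h' : Filter.map (fun n => f^[n + a] y) atTop = Filter.map (fun n => f^[n] y) atTop := by
    conv_rhs => rw [← Filter.map_add_atTop_eq_nat a, Filter.map_map]
    rfl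
  rw [MapClusterPt, MapClusterPt, h']

theorem exists_mem_omegaSet_dist_le [CompactSpace X] {ε : ℝ} {y z q : X}
    (h : ∀ i, dist (f^[i] y) (f^[i] z) ≤ ε) (hq : q ∈ omegaSet f y) :
    ∃ q' ∈ omegaSet f z, dist q q' ≤ ε := by
  obtain ⟨φ, hφ, hq⟩ := (mem_omegaSet_iff f y q).1 hq
  obtain ⟨q', ψ, hψ, hq'⟩ := CompactSpace.tendsto_subseq fun j => f^[φ j] z
  exact ⟨q', (mem_omegaSet_iff f z q').2 ⟨φ ∘ ψ, hφ.comp hψ, hq'⟩,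
    le_of_tendsto ((hq.comp hψ.tendsto_atTop).dist hq') (Eventually.of_forall fun j => h _)⟩

theorem IsChainContAt.exists_dist_iterate_le (hf : Continuous f) {x : X}
    (hx : IsChainContAt f x) {ε : ℝ} (hε : 0 < ε) :
    ∃ δ > 0, ∀ y, dist y x < δ → ∀ i, dist (f^[i] y) (f^[i] x) ≤ ε := by
  obtain ⟨δ, hδ, h⟩ := hx ε hε
  obtain ⟨η, hη, hcont⟩ := Metric.continuousAt_iff.1 (hf.continuousAt (x := x)) δ hδ
  refine ⟨min ε η, lt_min hε hη, fun y hy i => ?_⟩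
  rcases Nat.eq_zero_or_pos i with rfl | hi
  · exact hy.le.trans (min_le_left _ _)
  · -- The orbit of `y`, with its first point replaced by `x`.
    have := h (fun i => if i = 0 then x else f^[i] y) (fun i => ?_) (by simp) i
    · simpa [hi.ne'] using this
    · rcases Nat.eq_zero_or_pos i with rfl | hi
      · have := hcont (hy.trans_le (min_le_right _ _))
        rw [dist_comm] at this
        simpa using this.le
      · simp [hi.ne', Function.iterate_succ_apply', hδ.le]

theorem IsChainContAt.isOmegaUSC [CompactSpace X] (hf : Continuous f) {x : X}
    (hx : IsChainContAt f x) : IsOmegaUSC f x := by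
  refine (isOmegaUSC_iff f x).2 fun U hU hxU => ?_
  obtain ⟨r, hr, hrU⟩ := (isClosed_omegaLimit atTop (fun n : ℕ => f^[n])
    ({x} : Set X)).isCompact.exists_thickening_subset_open hU hxU
  obtain ⟨δ, hδ, h⟩ := hx.exists_dist_iterate_le hf (half_pos hr)
  refine ⟨δ, hδ, fun y hy q hq => hrU ?_⟩
  obtain ⟨q', hq', hd⟩ := exists_mem_omegaSet_dist_le (h y hy) hq
  exact Metric.mem_thickening_iff.2 ⟨q', hq', by linarith⟩

theorem IsChainContAt.isOmegaLSC [CompactSpace X] (hf : Continuous f) {x : X}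
    (hx : IsChainContAt f x) : IsOmegaLSC f x := by
  refine (isOmegaLSC_iff f x).2 fun U hU ⟨q, hq, hqU⟩ => ?_
  obtain ⟨r, hr, hrU⟩ := Metric.isOpen_iff.1 hU q hqU
  obtain ⟨δ, hδ, h⟩ := hx.exists_dist_iterate_le hf (half_pos hr)
  refine ⟨δ, hδ, fun y hy => ?_⟩
  obtain ⟨q', hq', hd⟩ := exists_mem_omegaSet_dist_le
    (fun i => (dist_comm _ _).trans_le (h y hy i)) hq
  exact ⟨q', hq', hrU (by rw [Metric.mem_ball, dist_comm]; linarith)⟩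

theorem IsChainContAt.isOmegaCont [CompactSpace X] (hf : Continuous f) {x : X}
    (hx : IsChainContAt f x) : IsOmegaCont f x := by
  refine (isOmegaCont_iff f x).2 fun ε hε => ?_
  obtain ⟨δ, hδ, h⟩ := hx.exists_dist_iterate_le hf (half_pos hε)
  refine ⟨δ, hδ, fun y hy => lt_of_le_of_lt ?_ (half_lt_self hε)⟩
  exact Metric.hausdorffDist_le_of_mem_dist (half_pos hε).le
    (fun q hq => exists_mem_omegaSet_dist_le (h y hy) hq)
    (fun q hq => exists_mem_omegaSet_dist_le (fun i => (dist_comm _ _).trans_le (h y hy i)) hq)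

/-! ### Sources of returning chains -/

/-- Shadowing a chain from `x` to `z` followed by the orbit of `z`. -/
theorem IsShadowable.exists_tail_close {x z : X} (hx : IsShadowable f x) (hxz : ChainTo f x z)
    {ε : ℝ} (hε : 0 < ε) :
    ∃ y w, dist y x ≤ ε ∧ omegaSet f w = omegaSet f y ∧
      ∀ i, dist (f^[i] z) (f^[i] w) ≤ ε := by
  obtain ⟨δ, hδ, h⟩ := hx ε hε
  obtain ⟨k, -, c, c0, ck, hc⟩ := hxz δ hδ
  obtain ⟨y, hy⟩ := h (fun n => if n < k then c n else f^[n - k] z) (fun n => by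
    rcases lt_trichotomy (n + 1) k with hn | hn | hn
    · have h1 : n < k := by omega
      simpa [h1, hn] using hc n h1
    · have h1 : n < k := by omega
      have h2 := hc n h1
      rw [hn, ck] at h2
      simpa [h1, hn] using h2
    · have h1 : ¬ n < k := by omega
      have h2 : ¬ n + 1 < k := by omega
      have h3 : n + 1 - k = n - k + 1 := by omega
      simp [h1, h2, h3, Function.iterate_succ_apply', hδ.le]) (by
    rcases Nat.eq_zero_or_pos k with rfl | hk
    · simp [← ck, c0]
    · simp [hk, c0])
  refine ⟨y, f^[k] y, ?_, omegaSet_iterate k y, fun i => ?_⟩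
  · rw [dist_comm]
    rcases Nat.eq_zero_or_pos k with rfl | hk
    · simpa [← ck, c0] using hy 0
    · simpa [hk, c0] using hy 0
  · have := hy (i + k)
    simpa [Function.iterate_add_apply] using this

theorem IsOmegaUSC.omegaSet_subset [CompactSpace X] {x z : X} (hx : IsShadowable f x)
    (hu : IsOmegaUSC f x) (hxz : ChainTo f x z) : omegaSet f z ⊆ omegaSet f x := by
  intro q hq
  by_contra hqx
  obtain ⟨r, hr, hrx⟩ := Metric.nhds_basis_closedBall.mem_iff.1
    ((isClosed_omegaLimit atTop (fun n : ℕ => f^[n]) ({x} : Set X)).isOpen_compl.mem_nhds hqx)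
  obtain ⟨δ, hδ, h⟩ := (isOmegaUSC_iff f x).1 hu (Metric.closedBall q r)ᶜ
    Metric.isClosed_closedBall.isOpen_compl (fun s hs hs' => hrx hs' hs)
  obtain ⟨y, w, hyx, hwy, hw⟩ := hx.exists_tail_close hxz (lt_min (half_pos hδ) hr)
  obtain ⟨q', hq', hd⟩ := exists_mem_omegaSet_dist_le hw hq
  rw [hwy] at hq'
  refine h y (by linarith [hyx.trans (min_le_left _ _)]) hq' ?_
  rw [Metric.mem_closedBall, dist_comm]
  exact hd.trans (min_le_right _ _)

theorem IsOmegaLSC.subset_omegaSet [CompactSpace X] {x z : X} (hx : IsShadowable f x)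
    (hl : IsOmegaLSC f x) (hxz : ChainTo f x z) : omegaSet f x ⊆ omegaSet f z := by
  intro q hq
  by_contra hqz
  obtain ⟨r, hr, hrz⟩ := Metric.nhds_basis_ball.mem_iff.1
    ((isClosed_omegaLimit atTop (fun n : ℕ => f^[n]) ({z} : Set X)).isOpen_compl.mem_nhds hqz)
  obtain ⟨δ, hδ, h⟩ := (isOmegaLSC_iff f x).1 hl (Metric.ball q (r / 2)) Metric.isOpen_ball
    ⟨q, hq, Metric.mem_ball_self (half_pos hr)⟩
  obtain ⟨y, w, hyx, hwy, hw⟩ := hx.exists_tail_close hxz (lt_min (half_pos hδ) (half_pos hr))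
  obtain ⟨q', hq', hd⟩ := h y (by linarith [hyx.trans (min_le_left _ _)])
  rw [← hwy] at hq'
  obtain ⟨s, hs, hd'⟩ := exists_mem_omegaSet_dist_le
    (fun i => (dist_comm _ _).trans_le (hw i)) hq'
  refine hrz (Metric.mem_ball.2 ?_) hs
  rw [Metric.mem_ball] at hd
  have := hd'.trans (min_le_right _ _)
  linarith [dist_triangle_left s q q']

theorem chainTo_return_of_semicontinuous [CompactSpace X] (hf : Continuous f) {x p : X}
    (hx : IsShadowable f x) (h : IsOmegaUSC f x ∨ IsOmegaLSC f x) (hp : p ∈ omegaSet f x)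
    (z : X) (hpz : ChainTo f p z) : ChainTo f z p := by
  have hxz := (chainTo_of_mem_omegaSet_self hp).trans hpz
  obtain ⟨w, hwx, hwz⟩ : ∃ w, w ∈ omegaSet f x ∧ w ∈ omegaSet f z := by
    rcases h with h | h
    · obtain ⟨w, hw⟩ := omegaSet_nonempty f z
      exact ⟨w, h.omegaSet_subset hx hxz hw, hw⟩
    · exact ⟨p, hp, h.subset_omegaSet hx hxz hp⟩
  exact (chainTo_of_mem_omegaSet_self hwz).trans (chainTo_of_mem_omegaSet hf hwx hp)

theorem chainTo_return_of_isTerminal [CompactSpace X] (hf : Continuous f) {x p : X}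
    (h : IsTerminal f (chainComponentOf f x)) (hp : p ∈ omegaSet f x)
    (z : X) (hpz : ChainTo f p z) : ChainTo f z p := by
  obtain ⟨⟨y, -, hC⟩, hsub⟩ := (chainComponentOf_eq_iff hf x _).1 rfl
  have hpC := hsub hp
  have hzC := h.2.2.2 p hpC z hpz
  rw [hC] at hpC hzC
  exact hzC.2.2.trans hpC.2.1

end OmegaShadow

theorem corollary4p3 {X : Type*} [MetricSpace X] [CompactSpace X] (f : X → X)
    (hf : Continuous f) (x : X) (hx : OmegaShadow.IsShadowable f x) :
    (OmegaShadow.IsTerminal f (OmegaShadow.chainComponentOf f x) →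
      ¬ OmegaShadow.IsOmegaCont f x → OmegaShadow.IsEntropyPoint f x) ∧
    ((OmegaShadow.IsOmegaUSC f x ∨ OmegaShadow.IsOmegaLSC f x) →
      ¬ OmegaShadow.IsChainContAt f x → OmegaShadow.IsEntropyPoint f x) ∧
    (((OmegaShadow.IsOmegaUSC f x ∧ ¬ OmegaShadow.IsOmegaLSC f x) ∨
        (OmegaShadow.IsOmegaLSC f x ∧ ¬ OmegaShadow.IsOmegaUSC f x)) →
      OmegaShadow.IsEntropyPoint f x) := by
  obtain ⟨p, hp⟩ := OmegaShadow.omegaSet_nonempty f x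
  have key : (OmegaShadow.IsOmegaUSC f x ∨ OmegaShadow.IsOmegaLSC f x) →
      ¬ OmegaShadow.IsChainContAt f x → OmegaShadow.IsEntropyPoint f x := fun h hcc => by
    by_contra hent
    exact hcc (OmegaShadow.isChainContAt_of_return hf hx hp
      (OmegaShadow.chainTo_return_of_semicontinuous hf hx h hp) hent)
  refine ⟨fun hT hC => ?_, key, ?_⟩
  · by_contra hent
    exact hC ((OmegaShadow.isChainContAt_of_return hf hx hp
      (OmegaShadow.chainTo_return_of_isTerminal hf hT hp) hent).isOmegaCont hf)
  · rintro (⟨hu, hl⟩ | ⟨hl, hu⟩)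
    · exact key (Or.inl hu) fun hcc => hl (hcc.isOmegaLSC hf)
    · exact key (Or.inr hl) fun hcc => hu (hcc.isOmegaUSC hf)
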